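/- **Setting.** Let $L\ge 1$ and let $d_0,d_1,\dots,d_L$ be layer widths with $d_L=1$; put $d=d_0$. A linear $L$-layer message-passing network has weight matrices $W=(W^{(L)},\dots,W^{(1)})$, $W^{(j)}\in\mathbb{R}^{d_j\times d_{j-1}}$. On a finite simple undirected graph $G$ with $n$ vertices, adjacency matrix $A(G)$ and vertex-feature matrix $X\in\mathbb{R}^{d\times n}$, it computes, with $A'(G)=A(G)+I_n$, $$X^{(0)}=X,\qquad X^{(j)}=W^{(j)}X^{(j-1)}A'(G)\quad(1\le j\le L),\qquad \hat y=X^{(L)}\mathbf 1_n\in\mathbb{R}.$$ Let $(G_i,X_i,y_i)_{i=1}^k$ be training data, $G_i$ of order $n_i$, $X_i\in\mathbb{R}^{d\times n_i}$, $y_i\in\{-1,+1\}$, with predictions $\hat y_i$. The data are assumed separable: there is $\bar u\in\mathbb{R}^{d}$ with $y_i\,\bar u^{\intercal}X_iA'(G_i)^L\mathbf 1_{n_i}>0$ for all $i$. Let the loss $\ell:\mathbb{R}\to(0,\infty)$ be continuously differentiable with $\ell'(x)<0$ for all $x$, $\lim_{x\to-\infty}\ell(x)=\infty$ and $\lim_{x\to\infty}\ell(x)=0$.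 The empirical risk is $\mathcal R(W)=\frac1k\sum_{i=1}^k\ell(y_i\hat y_i)$. Let $W(t)$, $t\ge0$, be a gradient flow, i.e. a solution of $\frac{d}{dt}W(t)=-\nabla\mathcal R(W(t))$ on $[0,\infty)$, whose initialization satisfies $$\nabla\mathcal R(W(0))\neq 0\qquad\text{and}\qquad \mathcal R(W(0))\le\mathcal R(0)=\ell(0).$$ **Theorem.** For every $t\ge0$ and $1\le j\le L$ let $u_j(t)\in\mathbb{R}^{d_j}$, $v_j(t)\in\mathbb{R}^{d_{j-1}}$ be any pair of left and right unit singular vectors of $W^{(j)}(t)$ belonging to its largest singular value $\sigma_j(t)$, i.e. $W^{(j)}(t)v_j(t)=\sigma_j(t)u_j(t)$ and $W^{(j)}(t)^{\intercal}u_j(t)=\sigma_j(t)v_j(t)$. Then, with $\|\cdot\|_F$ the Frobenius norm: - for every $j=1,\dots,L$, $$\lim_{t\to\infty}\left\|\frac{W^{(j)}(t)}{\|W^{(j)}(t)\|_F}-u_j(t)v_j(t)^{\intercal}\right\|_F=0;$$ - moreover, $$\lim_{t\to\infty}\left|\left\langle\frac{\left(W^{(L)}(t)\cdots W^{(1)}(t)\right)^{\intercal}}{\prod_{j=1}^L\|W^{(j)}(t)\|_F},\,v_1(t)\right\rangle\right|=1.$$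 -/

import Mathlib

open Filter Topology Set
open scoped Matrix Matrix.Norms.Frobenius

noncomputable section

namespace LinearMPNN

/-- A training example for graph classification: a finite simple graph with vertex set `Fin n`, a
`d₀ × n` matrix whose `v`-th column is the initial feature vector of the vertex `v`, and a class
label in `{-1, +1}`. -/
structure LabeledGraph (d₀ : ℕ) where
  n : ℕ
  graph : SimpleGraph (Fin n)
  features : Matrix (Fin d₀) (Fin n) ℝ
  label : ℝ
  label_mem : label = 1 ∨ label = -1

open Classical in
/-- The matrix `A'(G) = A(G) + I`. -/
def LabeledGraph.augAdj {d₀ : ℕ} (g : LabeledGraph d₀) : Matrix (Fin g.n) (Fin g.n) ℝ :=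
  g.graph.adjMatrix ℝ + 1

/-- The parameter space of an `L`-layer network with widths `d 0, d 1, …, d L`: the Euclidean space
of all entries of all weight matrices. Layers are numbered from `0`, so that the index `j` stands
for the `(j + 1)`-st weight matrix, which has size `d (j + 1) × d j`. The Euclidean inner product on
this space is the sum of the Frobenius inner products of the weight matrices. -/
abbrev Params (L : ℕ) (d : ℕ → ℕ) : Type :=
  EuclideanSpace ℝ (Σ j : Fin L, Fin (d (j + 1)) × Fin (d j))

variable {L : ℕ} {d : ℕ → ℕ}

/-- The weight matrix of layer `j`. -/
def weight (θ : Params L d) (j : Fin L) : Matrix (Fin (d (j + 1))) (Fin (d j)) ℝ :=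
  Matrix.of fun a b => θ ⟨j, (a, b)⟩

/-- The `d m × n` matrix of node embeddings after `m` layers:
`X⁽⁰⁾ = X` and `X⁽ᵐ⁺¹⁾ = W⁽ᵐ⁺¹⁾ X⁽ᵐ⁾ A'(G)`. -/
def embedding (θ : Params L d) (g : LabeledGraph (d 0)) :
    (m : ℕ) → m ≤ L → Matrix (Fin (d m)) (Fin g.n) ℝ
  | 0, _ => g.features
  | m + 1, h => weight θ ⟨m, h⟩ * embedding θ g m (Nat.le_of_succ_le h) * g.augAdj

/-- The sum readout `X⁽ᴸ⁾ 1` of the final node embeddings, a vector of dimension `d L`. -/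
def readout (θ : Params L d) (g : LabeledGraph (d 0)) : Fin (d L) → ℝ :=
  embedding θ g L le_rfl *ᵥ 1

/-- The only index of the output layer, which has width one. -/
def outIdx (hd : d L = 1) : Fin (d L) := ⟨0, by omega⟩

/-- The scalar prediction of the network. -/
def prediction (hd : d L = 1) (θ : Params L d) (g : LabeledGraph (d 0)) : ℝ :=
  readout θ g (outIdx hd)

/-- The empirical risk `(1/k) ∑ ℓ(yᵢ ŷᵢ)`. -/
def risk (hd : d L = 1) (ℓ : ℝ → ℝ) {k : ℕ} (data : Fin k → LabeledGraph (d 0))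
    (θ : Params L d) : ℝ :=
  (1 / (k : ℝ)) * ∑ i, ℓ ((data i).label * prediction hd θ (data i))

/-- The product `W⁽ᵐ⁾ ⋯ W⁽¹⁾` of the first `m` weight matrices. -/
def weightProd (θ : Params L d) : (m : ℕ) → m ≤ L → Matrix (Fin (d m)) (Fin (d 0)) ℝ
  | 0, _ => 1
  | m + 1, h => weight θ ⟨m, h⟩ * weightProd θ m (Nat.le_of_succ_le h)

/-- The transpose `(W⁽ᴸ⁾ ⋯ W⁽¹⁾)ᵀ` of the full product, as a vector in `ℝ^(d 0)`. -/
def prodVec (hd : d L = 1) (θ : Params L d) : Fin (d 0) → ℝ :=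
  (weightProd θ L le_rfl)ᵀ.col (outIdx hd)

/-- The assumption on the loss: positive, continuously differentiable with negative derivative,
tending to `∞` at `-∞` and to `0` at `∞`. -/
structure LossAssumption (ℓ : ℝ → ℝ) : Prop where
  pos : ∀ x, 0 < ℓ x
  contDiff : ContDiff ℝ 1 ℓ
  deriv_neg : ∀ x, deriv ℓ x < 0
  tendsto_atBot : Tendsto ℓ atBot atTop
  tendsto_atTop : Tendsto ℓ atTop (𝓝 0)

/-- The data can be classified correctly: some `ū` has
`yᵢ ūᵀ Xᵢ A'(Gᵢ)ᴸ 1 > 0` for every example. -/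
def Separable (L : ℕ) {d₀ k : ℕ} (data : Fin k → LabeledGraph d₀) : Prop :=
  ∃ ubar : Fin d₀ → ℝ, ∀ i,
    0 < (data i).label * (ubar ⬝ᵥ (((data i).features * (data i).augAdj ^ L) *ᵥ 1))

/-- `W` is a gradient flow of `R` on `[0, ∞)`, that is, `dW/dt = -∇R(W)`
(with the one-sided derivative at `t = 0`). -/
def IsGradientFlow (R : Params L d → ℝ) (W : ℝ → Params L d) : Prop :=
  ∀ t, 0 ≤ t → HasDerivWithinAt W (-gradient R (W t)) (Ici 0) t

/-- `u` and `v` are a pair of left and right unit singular vectors of `M` for its largest singular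
value. Mathlib lists the singular values in decreasing order, so the largest one has index `0`. -/
def IsTopSingularPair {m n : ℕ} (M : Matrix (Fin m) (Fin n) ℝ)
    (u : Fin m → ℝ) (v : Fin n → ℝ) : Prop :=
  u ⬝ᵥ u = 1 ∧ v ⬝ᵥ v = 1 ∧
    M *ᵥ v = (Matrix.toEuclideanLin M).singularValues 0 • u ∧
    Mᵀ *ᵥ u = (Matrix.toEuclideanLin M).singularValues 0 • v

end LinearMPNN

end

/-! Without nonlinearities the network is a linear predictor whose coefficient vector `w` is the
transposed product of the weights, so the risk depends on the weights only through `w`.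

The risk tends to zero. It drops strictly below its value at zero parameters, which keeps `w` away
from `0` (`exists_pos_le_dotProduct_self`). If the risk also stayed above some `ε`, its slope along
a separating direction would be bounded below (`exists_pos_le_slope`); a perturbation of the first
layer realizes this direction (`prodVec_dotProduct_le`), so `‖∇R‖ ‖W‖` would be bounded below. But
finite energy makes a gradient flow grow at most like `√T`, so each time interval `[s, 2s]` would
cost a fixed amount of risk (`gradientFlow_not_bounded_below`). Vanishing risk needs unbounded
margins, hence unbounded weights.

The layers align. Shifting a factor between neighbouring layers does not change the product to first
order, so the quadratic forms of `W_{p+1}ᵀ W_{p+1} - W_p W_pᵀ` are conserved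
(`imbalance_eq_initial`). Hence all squared Frobenius norms grow by the same amount. The last layer
has rank at most one, and balancedness carries this downwards: `‖W_j‖² - σ_j²` stays bounded
(`exists_norm_sq_sub_topSing_sq_le`). Since `‖W_j‖` diverges, `σ_j / ‖W_j‖` tends to `1`. The same
comparison aligns `u_p` with `v_{p+1}` up to sign, and chaining these alignments gives the claim on
the product. -/

namespace LinearMPNN

/-! ### Frobenius norms and top singular pairs. -/

section MatrixFacts

variable {m n : ℕ}

theorem frobenius_norm_sq (M : Matrix (Fin m) (Fin n) ℝ) : ‖M‖ ^ 2 = ∑ a, ∑ b, M a b ^ 2 := by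
  rw [Matrix.frobenius_norm_def, ← Real.sqrt_eq_rpow, Real.sq_sqrt (by positivity)]
  simp

theorem frobenius_norm_sq_eq_sum_mulVec (M : Matrix (Fin m) (Fin n) ℝ) :
    ‖M‖ ^ 2 = ∑ b, (M *ᵥ Pi.single b 1) ⬝ᵥ (M *ᵥ Pi.single b 1) := by
  rw [frobenius_norm_sq, Finset.sum_comm]
  simp [dotProduct, sq]

theorem dotProduct_self_nonneg_real (x : Fin n → ℝ) : 0 ≤ x ⬝ᵥ x :=
  Finset.sum_nonneg fun i _ => mul_self_nonneg (x i)

theorem dotProduct_sq_le (x y : Fin n → ℝ) : (x ⬝ᵥ y) ^ 2 ≤ (x ⬝ᵥ x) * (y ⬝ᵥ y) := by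
  have := Finset.sum_mul_sq_le_sq_mul_sq Finset.univ x y
  simpa [dotProduct, sq] using this

theorem mulVec_dotProduct_self_le (M : Matrix (Fin m) (Fin n) ℝ) (x : Fin n → ℝ) :
    (M *ᵥ x) ⬝ᵥ (M *ᵥ x) ≤ ‖M‖ ^ 2 * (x ⬝ᵥ x) := by
  rw [frobenius_norm_sq, Finset.sum_mul]
  refine Finset.sum_le_sum fun a _ => ?_
  have := dotProduct_sq_le (M a) x
  simpa [dotProduct, sq, Matrix.mulVec] using this

theorem frobenius_norm_sq_vecMulVec (x : Fin m → ℝ) (y : Fin n → ℝ) :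
    ‖Matrix.vecMulVec x y‖ ^ 2 = (x ⬝ᵥ x) * (y ⬝ᵥ y) := by
  rw [frobenius_norm_sq, dotProduct, dotProduct, Finset.sum_mul_sum]
  exact Finset.sum_congr rfl fun a _ => Finset.sum_congr rfl fun b _ => by
    simp [Matrix.vecMulVec_apply]; ring

theorem frobenius_norm_sq_sub_smul_vecMulVec (M : Matrix (Fin m) (Fin n) ℝ) (c e : ℝ)
    (x : Fin m → ℝ) (y : Fin n → ℝ) :
    ‖c • M - e • Matrix.vecMulVec x y‖ ^ 2 =
      c ^ 2 * ‖M‖ ^ 2 - 2 * c * e * (x ⬝ᵥ (M *ᵥ y)) + e ^ 2 * ((x ⬝ᵥ x) * (y ⬝ᵥ y)) := by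
  rw [← frobenius_norm_sq_vecMulVec, frobenius_norm_sq, frobenius_norm_sq, frobenius_norm_sq]
  simp only [dotProduct, Matrix.mulVec, Finset.mul_sum, ← Finset.sum_sub_distrib,
    ← Finset.sum_add_distrib]
  refine Finset.sum_congr rfl fun a _ => Finset.sum_congr rfl fun b _ => ?_
  simp [Matrix.vecMulVec_apply]
  ring

/-- Expand `x` in an eigenbasis of `T* T`: the eigenvalues are the squared singular values, all at
most the one of index `0`. -/
theorem _root_.LinearMap.norm_apply_sq_le_singularValues_zero {E F : Type*}
    [NormedAddCommGroup E] [InnerProductSpace ℝ E] [FiniteDimensional ℝ E]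
    [NormedAddCommGroup F] [InnerProductSpace ℝ F] [FiniteDimensional ℝ F]
    (T : E →ₗ[ℝ] F) (x : E) : ‖T x‖ ^ 2 ≤ T.singularValues 0 ^ 2 * ‖x‖ ^ 2 := by
  have hS := T.isSymmetric_adjoint_comp_self
  set b := hS.eigenvectorBasis rfl
  have h1 : ‖T x‖ ^ 2 = inner ℝ x ((T.adjoint ∘ₗ T) x) := by
    rw [LinearMap.comp_apply, LinearMap.adjoint_inner_right, real_inner_self_eq_norm_sq]
  rw [h1, ← b.sum_inner_mul_inner, ← b.sum_sq_norm_inner_right x, Finset.mul_sum]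
  refine Finset.sum_le_sum fun i _ => ?_
  have h2 : inner ℝ (b i) ((T.adjoint ∘ₗ T) x) = T.singularValues i ^ 2 * inner ℝ (b i) x := by
    rw [← hS, hS.apply_eigenvectorBasis, T.sq_singularValues_fin rfl i, inner_smul_left]
    simp [b]
  rw [h2, real_inner_comm, Real.norm_eq_abs, sq_abs]
  have h3 : T.singularValues i ^ 2 ≤ T.singularValues 0 ^ 2 :=
    pow_le_pow_left₀ (T.singularValues_nonneg _) (T.singularValues_antitone (Nat.zero_le _)) 2
  nlinarith [sq_nonneg (inner ℝ (b i) x)]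

theorem norm_toLp_sq (x : Fin n → ℝ) : ‖WithLp.toLp 2 x‖ ^ 2 = x ⬝ᵥ x := by
  rw [EuclideanSpace.real_norm_sq_eq]
  simp [dotProduct, sq]

/-- The largest singular value of a matrix. -/
noncomputable def topSing (M : Matrix (Fin m) (Fin n) ℝ) : ℝ := (Matrix.toEuclideanLin M).singularValues 0

theorem topSing_nonneg (M : Matrix (Fin m) (Fin n) ℝ) : 0 ≤ topSing M :=
  LinearMap.singularValues_nonneg _ _

theorem mulVec_dotProduct_self_le_topSing (M : Matrix (Fin m) (Fin n) ℝ) (x : Fin n → ℝ) :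
    (M *ᵥ x) ⬝ᵥ (M *ᵥ x) ≤ topSing M ^ 2 * (x ⬝ᵥ x) := by
  have := (Matrix.toEuclideanLin M).norm_apply_sq_le_singularValues_zero (WithLp.toLp 2 x)
  rwa [Matrix.toLpLin_toLp, Matrix.toLin'_apply, norm_toLp_sq, norm_toLp_sq] at this

theorem transpose_mulVec_dotProduct (M : Matrix (Fin m) (Fin n) ℝ) (x : Fin m → ℝ)
    (y : Fin n → ℝ) : (Mᵀ *ᵥ x) ⬝ᵥ y = x ⬝ᵥ (M *ᵥ y) := by
  rw [Matrix.mulVec_transpose, Matrix.dotProduct_mulVec]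

theorem transpose_mulVec_dotProduct_self_le_topSing (M : Matrix (Fin m) (Fin n) ℝ)
    (x : Fin m → ℝ) : (Mᵀ *ᵥ x) ⬝ᵥ (Mᵀ *ᵥ x) ≤ topSing M ^ 2 * (x ⬝ᵥ x) := by
  set a := (Mᵀ *ᵥ x) ⬝ᵥ (Mᵀ *ᵥ x) with ha
  have h1 : a = x ⬝ᵥ (M *ᵥ (Mᵀ *ᵥ x)) := transpose_mulVec_dotProduct M x _
  -- Cauchy–Schwarz and the bound for `M` suffice after dividing by `a`; the singular values of `Mᵀ`
  -- are not needed.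
  have h2 : a ^ 2 ≤ (x ⬝ᵥ x) * (topSing M ^ 2 * a) := by
    rw [h1]
    exact (dotProduct_sq_le _ _).trans (by
      rw [← h1]
      exact mul_le_mul_of_nonneg_left (mulVec_dotProduct_self_le_topSing M _)
        (dotProduct_self_nonneg_real x))
  have h3 : 0 ≤ a := dotProduct_self_nonneg_real _
  rcases h3.eq_or_lt with h | h
  · rw [← h]
    exact mul_nonneg (sq_nonneg _) (dotProduct_self_nonneg_real x)
  · exact le_of_mul_le_mul_right (by nlinarith) h

theorem IsTopSingularPair.dotProduct_mulVec {M : Matrix (Fin m) (Fin n) ℝ} {u : Fin m → ℝ}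
    {v : Fin n → ℝ} (h : IsTopSingularPair M u v) : u ⬝ᵥ (M *ᵥ v) = topSing M := by
  rw [h.2.2.1, dotProduct_smul, h.1]
  simp [topSing]

theorem IsTopSingularPair.mulVec_dotProduct_self {M : Matrix (Fin m) (Fin n) ℝ} {u : Fin m → ℝ}
    {v : Fin n → ℝ} (h : IsTopSingularPair M u v) :
    (M *ᵥ v) ⬝ᵥ (M *ᵥ v) = topSing M ^ 2 := by
  rw [h.2.2.1, dotProduct_smul, smul_dotProduct, h.1]
  simp [topSing, sq]

theorem IsTopSingularPair.topSing_sq_le {M : Matrix (Fin m) (Fin n) ℝ} {u : Fin m → ℝ}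
    {v : Fin n → ℝ} (h : IsTopSingularPair M u v) : topSing M ^ 2 ≤ ‖M‖ ^ 2 := by
  have := mulVec_dotProduct_self_le M v
  rwa [h.mulVec_dotProduct_self, h.2.1, mul_one] at this

theorem IsTopSingularPair.topSing_le {M : Matrix (Fin m) (Fin n) ℝ} {u : Fin m → ℝ}
    {v : Fin n → ℝ} (h : IsTopSingularPair M u v) : topSing M ≤ ‖M‖ :=
  (sq_le_sq₀ (topSing_nonneg M) (norm_nonneg M)).1 h.topSing_sq_le

/-- Apart from its top singular direction, a matrix is bounded by the rest of its Frobenius norm. -/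
theorem IsTopSingularPair.transpose_mulVec_le {M : Matrix (Fin m) (Fin n) ℝ} {u : Fin m → ℝ}
    {v : Fin n → ℝ} (h : IsTopSingularPair M u v) (x : Fin m → ℝ) (hx : x ⬝ᵥ x = 1) :
    (Mᵀ *ᵥ x) ⬝ᵥ (Mᵀ *ᵥ x) ≤ topSing M ^ 2 * (u ⬝ᵥ x) ^ 2 + (‖M‖ ^ 2 - topSing M ^ 2) := by
  set s := topSing M
  -- Remove the top rank-one part: `Eᵀ x` is orthogonal to `v`, so by Pythagoras only `‖E‖² = ‖M‖² -
  -- s²` is lost.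
  set E := M - s • Matrix.vecMulVec u v with hE
  have hEn : ‖E‖ ^ 2 = ‖M‖ ^ 2 - s ^ 2 := by
    have := frobenius_norm_sq_sub_smul_vecMulVec M 1 s u v
    rw [one_smul, h.1, h.2.1, h.dotProduct_mulVec] at this
    rw [hE, this]; ring
  have hEx : Eᵀ *ᵥ x = Mᵀ *ᵥ x - (s * (u ⬝ᵥ x)) • v := by
    rw [hE, Matrix.transpose_sub, Matrix.sub_mulVec, Matrix.transpose_smul, Matrix.smul_mulVec,
      Matrix.transpose_vecMulVec, Matrix.vecMulVec_mulVec, mul_smul]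
    simp
  have hle := mulVec_dotProduct_self_le Eᵀ x
  rw [Matrix.frobenius_norm_transpose, hEn, hx, hEx, mul_one] at hle
  have hv : (Mᵀ *ᵥ x) ⬝ᵥ v = s * (u ⬝ᵥ x) := by
    rw [transpose_mulVec_dotProduct, h.2.2.1, dotProduct_smul, dotProduct_comm]
    rfl
  simp only [sub_dotProduct, dotProduct_sub, smul_dotProduct, dotProduct_smul, smul_eq_mul, hv,
    h.2.1, dotProduct_comm v] at hle
  nlinarith

theorem IsTopSingularPair.norm_normalized_sub_sq {M : Matrix (Fin m) (Fin n) ℝ} {u : Fin m → ℝ}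
    {v : Fin n → ℝ} (h : IsTopSingularPair M u v) (hM : ‖M‖ ≠ 0) :
    ‖‖M‖⁻¹ • M - Matrix.vecMulVec u v‖ ^ 2 = 2 - 2 * (topSing M / ‖M‖) := by
  have := frobenius_norm_sq_sub_smul_vecMulVec M ‖M‖⁻¹ 1 u v
  rw [one_smul, h.1, h.2.1, h.dotProduct_mulVec] at this
  rw [this]
  field_simp
  ring

/-- If `u` is nearly parallel to both `x` and `v`, then `v` is nearly parallel to `x`. -/
theorem abs_dotProduct_lower_bound (u v x : Fin n → ℝ) (hu : u ⬝ᵥ u = 1) (hv : v ⬝ᵥ v = 1)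
    (hx : x ⬝ᵥ x ≤ 1) :
    |u ⬝ᵥ x| * |u ⬝ᵥ v| - √(1 - (u ⬝ᵥ x) ^ 2) ≤ |v ⬝ᵥ x| := by
  -- The part of `x` orthogonal to `u` has squared length at most `1 - (u ⬝ᵥ x) ^ 2`, which bounds
  -- its pairing with `v`.
  set r := x - (u ⬝ᵥ x) • u with hr
  have h1 : r ⬝ᵥ r = x ⬝ᵥ x - (u ⬝ᵥ x) ^ 2 := by
    simp only [hr, sub_dotProduct, dotProduct_sub, smul_dotProduct, dotProduct_smul, smul_eq_mul,
      hu, dotProduct_comm x u]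
    ring
  have h2 : v ⬝ᵥ r = v ⬝ᵥ x - (u ⬝ᵥ x) * (u ⬝ᵥ v) := by
    simp only [hr, dotProduct_sub, dotProduct_smul, smul_eq_mul, dotProduct_comm v u]
  have h3 : |v ⬝ᵥ r| ≤ √(1 - (u ⬝ᵥ x) ^ 2) := by
    refine Real.abs_le_sqrt ((dotProduct_sq_le v r).trans ?_)
    rw [hv, h1]
    linarith
  rw [h2] at h3
  rw [← abs_mul]
  have h4 := abs_sub_abs_le_abs_sub ((u ⬝ᵥ x) * (u ⬝ᵥ v)) (v ⬝ᵥ x)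
  rw [abs_sub_comm] at h4
  linarith

end MatrixFacts

end LinearMPNN

namespace LinearMPNN

/-! ### Derivatives of the weight product and of the risk. -/

section Derivatives

variable {L : ℕ} {d : ℕ → ℕ}

theorem weight_add (θ δ : Params L d) (j : Fin L) : weight (θ + δ) j = weight θ j + weight δ j := by
  ext; simp [weight]

theorem weight_smul (s : ℝ) (θ : Params L d) (j : Fin L) : weight (s • θ) j = s • weight θ j := by
  ext; simp [weight]

theorem weight_apply (θ : Params L d) (j : Fin L) (a : Fin (d (j + 1))) (b : Fin (d j)) :
    weight θ j a b = θ ⟨j, (a, b)⟩ := rfl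

theorem inner_eq_sum_weight (θ δ : Params L d) :
    inner ℝ θ δ = ∑ j, ∑ a, ∑ b, weight θ j a b * weight δ j a b := by
  rw [PiLp.inner_apply, Fintype.sum_sigma]
  refine Finset.sum_congr rfl fun j _ => ?_
  rw [Fintype.sum_prod_type]
  simp [weight_apply, mul_comm]

theorem norm_sq_eq_sum_weight (θ : Params L d) : ‖θ‖ ^ 2 = ∑ j, ‖weight θ j‖ ^ 2 := by
  rw [← real_inner_self_eq_norm_sq, inner_eq_sum_weight]
  simp only [frobenius_norm_sq, ← sq]

theorem norm_weight_le (θ : Params L d) (j : Fin L) : ‖weight θ j‖ ≤ ‖θ‖ := by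
  rw [← sq_le_sq₀ (norm_nonneg _) (norm_nonneg _), norm_sq_eq_sum_weight]
  exact Finset.single_le_sum (f := fun j => ‖weight θ j‖ ^ 2) (fun _ _ => sq_nonneg _)
    (Finset.mem_univ j)

/-- The parameter vector with prescribed weight matrices. -/
def ofWeights (M : (j : Fin L) → Matrix (Fin (d (j + 1))) (Fin (d j)) ℝ) : Params L d :=
  WithLp.toLp 2 fun i => M i.1 i.2.1 i.2.2

theorem weight_ofWeights (M : (j : Fin L) → Matrix (Fin (d (j + 1))) (Fin (d j)) ℝ) (j : Fin L) :
    weight (ofWeights M) j = M j := by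
  ext; simp [weight, ofWeights]

/-- The derivative of the partial products of the weight matrices in direction `δ`. -/
def weightProdDeriv (θ δ : Params L d) : (m : ℕ) → m ≤ L → Matrix (Fin (d m)) (Fin (d 0)) ℝ
  | 0, _ => 0
  | m + 1, h => weight δ ⟨m, h⟩ * weightProd θ m (Nat.le_of_succ_le h) +
      weight θ ⟨m, h⟩ * weightProdDeriv θ δ m (Nat.le_of_succ_le h)

theorem differentiable_weight_apply (j : Fin L) (a : Fin (d (j + 1))) (b : Fin (d j)) :
    Differentiable ℝ fun θ : Params L d => weight θ j a b := by
  simp only [weight_apply]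
  fun_prop

theorem differentiable_weightProd_apply (m : ℕ) (h : m ≤ L) (a : Fin (d m)) (b : Fin (d 0)) :
    Differentiable ℝ fun θ : Params L d => weightProd θ m h a b := by
  induction m with
  | zero => simp [weightProd]
  | succ m ih =>
    simp only [weightProd, Matrix.mul_apply]
    exact Differentiable.fun_sum fun c _ =>
      (differentiable_weight_apply ⟨m, h⟩ a c).mul (ih _ c)

theorem hasDerivAt_weightProd (θ δ : Params L d) (m : ℕ) (h : m ≤ L) (a : Fin (d m))
    (b : Fin (d 0)) :
    HasDerivAt (fun s : ℝ => weightProd (θ + s • δ) m h a b) (weightProdDeriv θ δ m h a b) 0 := by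
  induction m with
  | zero => simpa [weightProd, weightProdDeriv] using hasDerivAt_const (0 : ℝ) _
  | succ m ih =>
    simp only [weightProd, weightProdDeriv, Matrix.mul_apply, Matrix.add_apply,
      ← Finset.sum_add_distrib]
    refine HasDerivAt.fun_sum fun c _ => ?_
    have h1 : HasDerivAt (fun s : ℝ => weight (θ + s • δ) ⟨m, h⟩ a c) (weight δ ⟨m, h⟩ a c) 0 := by
      simp only [weight_add, weight_smul, Matrix.add_apply, Matrix.smul_apply, smul_eq_mul]
      simpa using ((hasDerivAt_id (0 : ℝ)).mul_const (weight δ ⟨m, h⟩ a c)).const_add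
        (weight θ ⟨m, h⟩ a c)
    convert! h1.mul (ih (Nat.le_of_succ_le h) c) using 1
    simp

theorem prodVec_apply (hd : d L = 1) (θ : Params L d) (b : Fin (d 0)) :
    prodVec hd θ b = weightProd θ L le_rfl (outIdx hd) b := rfl

/-- The derivative of the end-to-end vector in direction `δ`. -/
def prodVecDeriv (hd : d L = 1) (θ δ : Params L d) : Fin (d 0) → ℝ :=
  weightProdDeriv θ δ L le_rfl (outIdx hd)

/-- The effective input of a labelled graph for an `L`-layer network, multiplied by the label. -/
noncomputable def effectiveInput (L : ℕ) {d₀ : ℕ} (g : LabeledGraph d₀) : Fin d₀ → ℝ :=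
  g.label • ((g.features * g.augAdj ^ L) *ᵥ 1)

/-- Weights act from the left and the graph from the right, so the two kinds of factors separate. -/
theorem embedding_eq (θ : Params L d) (g : LabeledGraph (d 0)) (m : ℕ) (h : m ≤ L) :
    embedding θ g m h = weightProd θ m h * (g.features * g.augAdj ^ m) := by
  induction m with
  | zero => simp [embedding, weightProd]
  | succ m ih => simp only [embedding, weightProd, ih, pow_succ, Matrix.mul_assoc]

theorem label_mul_prediction (hd : d L = 1) (θ : Params L d) (g : LabeledGraph (d 0)) :
    g.label * prediction hd θ g = prodVec hd θ ⬝ᵥ effectiveInput L g := by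
  rw [prediction, readout, embedding_eq, ← Matrix.mulVec_mulVec, effectiveInput, dotProduct_smul]
  rfl

/-- The risk of the linear predictor `x ↦ w ⬝ᵥ x`. -/
noncomputable def linearRisk (ℓ : ℝ → ℝ) {k n : ℕ} (z : Fin k → Fin n → ℝ) (w : Fin n → ℝ) : ℝ :=
  (1 / (k : ℝ)) * ∑ i, ℓ (w ⬝ᵥ z i)

theorem risk_eq_linearRisk (hd : d L = 1) (ℓ : ℝ → ℝ) {k : ℕ} (data : Fin k → LabeledGraph (d 0))
    (θ : Params L d) :
    risk hd ℓ data θ = linearRisk ℓ (fun i => effectiveInput L (data i)) (prodVec hd θ) := by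
  simp only [risk, linearRisk, label_mul_prediction]

theorem differentiable_risk (hd : d L = 1) {ℓ : ℝ → ℝ} (hℓ : Differentiable ℝ ℓ) {k : ℕ}
    (data : Fin k → LabeledGraph (d 0)) : Differentiable ℝ (risk hd ℓ data) := by
  have : risk hd ℓ data = fun θ => (1 / (k : ℝ)) * ∑ i, ℓ (∑ b,
      weightProd θ L le_rfl (outIdx hd) b * effectiveInput L (data i) b) := by
    funext θ
    rw [risk_eq_linearRisk]
    rfl
  rw [this]
  refine Differentiable.const_mul (Differentiable.fun_sum fun i _ => hℓ.comp ?_) _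
  exact Differentiable.fun_sum fun b _ =>
    (differentiable_weightProd_apply L le_rfl _ b).mul_const _

/-- All later information about the gradient comes from testing this formula on well-chosen
directions `δ`. -/
theorem inner_gradient_risk (hd : d L = 1) {ℓ : ℝ → ℝ} (hℓ : Differentiable ℝ ℓ) {k : ℕ}
    (data : Fin k → LabeledGraph (d 0)) (θ δ : Params L d) :
    inner ℝ (gradient (risk hd ℓ data) θ) δ = (1 / (k : ℝ)) * ∑ i,
      deriv ℓ (prodVec hd θ ⬝ᵥ effectiveInput L (data i)) *
        (prodVecDeriv hd θ δ ⬝ᵥ effectiveInput L (data i)) := by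
  rw [inner_gradient_left]
  have h1 : HasDerivAt (fun s : ℝ => risk hd ℓ data (θ + s • δ))
      (fderiv ℝ (risk hd ℓ data) θ δ) 0 :=
    ((differentiable_risk hd hℓ data) θ).hasFDerivAt.hasLineDerivAt δ
  refine h1.unique ?_
  simp only [risk_eq_linearRisk, linearRisk]
  refine HasDerivAt.const_mul _ (HasDerivAt.fun_sum fun i _ => ?_)
  have h2 : HasDerivAt (fun s : ℝ => prodVec hd (θ + s • δ) ⬝ᵥ effectiveInput L (data i))
      (prodVecDeriv hd θ δ ⬝ᵥ effectiveInput L (data i)) 0 :=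
    HasDerivAt.fun_sum fun b _ =>
      (hasDerivAt_weightProd θ δ L le_rfl (outIdx hd) b).mul_const _
  have h3 := (hℓ (prodVec hd (θ + (0 : ℝ) • δ) ⬝ᵥ effectiveInput L (data i))).hasDerivAt.comp
    (0 : ℝ) h2
  convert! h3 using 1
  simp

/-- Multiplying the first weight matrix from the right by `B` multiplies the product by `B`. -/
theorem weightProdDeriv_firstLayer (hL : 0 < L) (θ δ : Params L d)
    (B : Matrix (Fin (d 0)) (Fin (d 0)) ℝ)
    (h0 : weight δ ⟨0, hL⟩ = weight θ ⟨0, hL⟩ * B)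
    (hδ : ∀ j : Fin L, (j : ℕ) ≠ 0 → weight δ j = 0) (m : ℕ) (h : m + 1 ≤ L) :
    weightProdDeriv θ δ (m + 1) h = weightProd θ (m + 1) h * B := by
  induction m with
  | zero =>
    simp only [weightProdDeriv, weightProd, Matrix.mul_one, Matrix.mul_zero, add_zero]
    exact h0
  | succ m ih =>
    rw [weightProdDeriv, ih, hδ _ (Nat.succ_ne_zero m), Matrix.zero_mul, zero_add,
      ← Matrix.mul_assoc]
    rfl

/-- Moving a factor from one layer to the next does not change the product to first order. -/
theorem weightProdDeriv_rebalance (θ δ : Params L d) (p : ℕ) (hp : p + 1 < L)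
    (B : Matrix (Fin (d (p + 1))) (Fin (d (p + 1))) ℝ)
    (h0 : weight δ ⟨p, Nat.lt_of_succ_lt hp⟩ = -(B * weight θ ⟨p, Nat.lt_of_succ_lt hp⟩))
    (h1 : weight δ ⟨p + 1, hp⟩ = weight θ ⟨p + 1, hp⟩ * B)
    (hδ : ∀ j : Fin L, (j : ℕ) ≠ p → (j : ℕ) ≠ p + 1 → weight δ j = 0) (m : ℕ) (h : m ≤ L)
    (hm : m ≠ p + 1) :
    weightProdDeriv θ δ m h = 0 := by
  have hlow : ∀ (m : ℕ) (h : m ≤ L), m ≤ p → weightProdDeriv θ δ m h = 0 := by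
    intro m
    induction m with
    | zero => intros; rfl
    | succ m ih =>
      intro h hm
      rw [weightProdDeriv, ih _ (by omega), hδ _ (by simp; omega) (by simp; omega)]
      simp
  rcases Nat.lt_or_ge m (p + 1) with hlt | hge
  · exact hlow m h (by omega)
  · obtain ⟨q, rfl⟩ : ∃ q, m = p + 2 + q := ⟨m - (p + 2), by omega⟩
    clear hm hge
    induction q with
    | zero =>
      -- Once both changed layers are included, the contributions of `B` and `-B` cancel; the
      -- product ending between them is the excluded case `m = p + 1`.
      simp only [Nat.add_zero, weightProdDeriv, weightProd]
      rw [hlow p _ le_rfl, h0, h1]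
      simp [Matrix.mul_assoc]
    | succ q ih =>
      have : weightProdDeriv θ δ (p + 2 + q + 1) h = 0 := by
        rw [weightProdDeriv, ih, hδ _ (by simp; omega) (by simp; omega)]
        simp
      exact this

end Derivatives

end LinearMPNN

namespace LinearMPNN

/-! ### Test directions for the gradient. -/

section Directions

variable {L : ℕ} {d : ℕ → ℕ}

/-- The parameter vector whose only nonzero weight matrix is `M` in layer `j`. -/
def layerSingle (j : Fin L) (M : Matrix (Fin (d (j + 1))) (Fin (d j)) ℝ) : Params L d :=
  ofWeights (Pi.single j M)

theorem weight_layerSingle_same (j : Fin L) (M : Matrix (Fin (d (j + 1))) (Fin (d j)) ℝ) :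
    weight (layerSingle j M) j = M := by
  rw [layerSingle, weight_ofWeights, Pi.single_eq_same]

theorem weight_layerSingle_of_ne {i j : Fin L} (h : i ≠ j)
    (M : Matrix (Fin (d (j + 1))) (Fin (d j)) ℝ) : weight (layerSingle j M) i = 0 := by
  rw [layerSingle, weight_ofWeights, Pi.single_eq_of_ne h]

theorem inner_layerSingle (θ : Params L d) (j : Fin L)
    (M : Matrix (Fin (d (j + 1))) (Fin (d j)) ℝ) :
    inner ℝ θ (layerSingle j M) = ∑ a, ∑ b, weight θ j a b * M a b := by
  rw [inner_eq_sum_weight, Finset.sum_eq_single j, weight_layerSingle_same]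
  · intro i _ hi
    simp [weight_layerSingle_of_ne hi]
  · simp

theorem inner_layerSingle_vecMulVec (θ : Params L d) (j : Fin L) (y : Fin (d (j + 1)) → ℝ)
    (x : Fin (d j) → ℝ) :
    inner ℝ θ (layerSingle j (Matrix.vecMulVec y x)) = y ⬝ᵥ (weight θ j *ᵥ x) := by
  rw [inner_layerSingle]
  simp only [dotProduct, Matrix.mulVec, Finset.mul_sum, Matrix.vecMulVec_apply]
  exact Finset.sum_congr rfl fun a _ => Finset.sum_congr rfl fun b _ => by ring

theorem norm_sq_layerSingle (j : Fin L) (M : Matrix (Fin (d (j + 1))) (Fin (d j)) ℝ) :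
    ‖layerSingle j M‖ ^ 2 = ‖M‖ ^ 2 := by
  rw [← real_inner_self_eq_norm_sq, inner_layerSingle, weight_layerSingle_same, frobenius_norm_sq]
  simp only [sq]

/-- Perturbing the first layer by `W₁ w ubarᵀ` moves `w` by `|w|² ubar`, while the perturbation has
norm at most `‖θ‖ |w| |ubar|`. Cauchy–Schwarz for the gradient then gives the bound after cancelling
one factor `|w|²`. -/
theorem prodVec_dotProduct_le (hL : 0 < L) (hd : d L = 1) {ℓ : ℝ → ℝ} (hℓ : Differentiable ℝ ℓ)
    {k : ℕ} (data : Fin k → LabeledGraph (d 0)) (θ : Params L d) (ubar : Fin (d 0) → ℝ) {c : ℝ}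
    (hc : 0 ≤ c)
    (h : c ≤ (1 / (k : ℝ)) * ∑ i, -deriv ℓ (prodVec hd θ ⬝ᵥ effectiveInput L (data i)) *
      (ubar ⬝ᵥ effectiveInput L (data i))) :
    c ^ 2 * (prodVec hd θ ⬝ᵥ prodVec hd θ) ≤
      ‖gradient (risk hd ℓ data) θ‖ ^ 2 * ‖θ‖ ^ 2 * (ubar ⬝ᵥ ubar) := by
  set w := prodVec hd θ with hw
  set δ : Params L d := layerSingle ⟨0, hL⟩
    (weight θ ⟨0, hL⟩ * Matrix.vecMulVec w ubar) with hδ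
  have hδn : ‖δ‖ ^ 2 ≤ ‖θ‖ ^ 2 * (w ⬝ᵥ w) * (ubar ⬝ᵥ ubar) := by
    have h2 : ‖weight θ ⟨0, hL⟩‖ ^ 2 ≤ ‖θ‖ ^ 2 :=
      pow_le_pow_left₀ (norm_nonneg _) (norm_weight_le θ _) 2
    rw [hδ, norm_sq_layerSingle, Matrix.mul_vecMulVec, frobenius_norm_sq_vecMulVec]
    exact mul_le_mul_of_nonneg_right ((mulVec_dotProduct_self_le _ _).trans
      (mul_le_mul_of_nonneg_right h2 (dotProduct_self_nonneg_real _)))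
      (dotProduct_self_nonneg_real _)
  have hder : prodVecDeriv hd θ δ = (w ⬝ᵥ w) • ubar := by
    obtain ⟨m, rfl⟩ : ∃ m, L = m + 1 := ⟨L - 1, by omega⟩
    have h1 := weightProdDeriv_firstLayer hL θ δ (Matrix.vecMulVec w ubar)
      (weight_layerSingle_same _ _)
      (fun j hj => weight_layerSingle_of_ne (fun h => hj (by rw [h])) _) m le_rfl
    funext b
    rw [prodVecDeriv, h1, Matrix.mul_vecMulVec, Matrix.vecMulVec_apply]
    rfl
  have hin := inner_gradient_risk hd hℓ data θ δ
  rw [hder] at hin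
  have hin' : inner ℝ (gradient (risk hd ℓ data) θ) δ = -((w ⬝ᵥ w) * ((1 / (k : ℝ)) *
      ∑ i, -deriv ℓ (w ⬝ᵥ effectiveInput L (data i)) *
        (ubar ⬝ᵥ effectiveInput L (data i)))) := by
    rw [hin]
    simp only [smul_dotProduct, smul_eq_mul, Finset.mul_sum, ← Finset.sum_neg_distrib]
    exact Finset.sum_congr rfl fun i _ => by ring
  have hww : 0 ≤ w ⬝ᵥ w := dotProduct_self_nonneg_real w
  have hcs := abs_real_inner_le_norm (gradient (risk hd ℓ data) θ) δ
  rw [hin', abs_neg] at hcs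
  have h1 : (w ⬝ᵥ w) * c ≤ ‖gradient (risk hd ℓ data) θ‖ * ‖δ‖ :=
    (mul_le_mul_of_nonneg_left h hww).trans ((le_abs_self _).trans hcs)
  have h2 := pow_le_pow_left₀ (mul_nonneg hww hc) h1 2
  rw [mul_pow, mul_pow] at h2
  have h3 := h2.trans (mul_le_mul_of_nonneg_left hδn (sq_nonneg _))
  rcases hww.eq_or_lt with h0 | h0
  · rw [← h0, mul_zero]
    exact mul_nonneg (by positivity) (dotProduct_self_nonneg_real _)
  · exact le_of_mul_le_mul_right (by nlinarith) h0

/-- The balancedness defect between the layers `p` and `p + 1`, tested on the vector `x`. -/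
def imbalance (θ : Params L d) (p : ℕ) (hp : p + 1 < L) (x : Fin (d (p + 1)) → ℝ) : ℝ :=
  (weight θ ⟨p + 1, hp⟩ *ᵥ x) ⬝ᵥ (weight θ ⟨p + 1, hp⟩ *ᵥ x) -
    ((weight θ ⟨p, Nat.lt_of_succ_lt hp⟩)ᵀ *ᵥ x) ⬝ᵥ ((weight θ ⟨p, Nat.lt_of_succ_lt hp⟩)ᵀ *ᵥ x)

/-- The gradient is orthogonal to the rebalancing direction with `B = x xᵀ`, along which the product
is stationary. -/
theorem gradient_risk_balanced (hd : d L = 1) {ℓ : ℝ → ℝ} (hℓ : Differentiable ℝ ℓ)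
    {k : ℕ} (data : Fin k → LabeledGraph (d 0)) (θ : Params L d) (p : ℕ) (hp : p + 1 < L)
    (x : Fin (d (p + 1)) → ℝ) :
    (weight θ ⟨p + 1, hp⟩ *ᵥ x) ⬝ᵥ
        (weight (gradient (risk hd ℓ data) θ) ⟨p + 1, hp⟩ *ᵥ x) =
      ((weight θ ⟨p, Nat.lt_of_succ_lt hp⟩)ᵀ *ᵥ x) ⬝ᵥ
        ((weight (gradient (risk hd ℓ data) θ) ⟨p, Nat.lt_of_succ_lt hp⟩)ᵀ *ᵥ x) := by
  set j0 : Fin L := ⟨p, Nat.lt_of_succ_lt hp⟩ with hj0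
  set j1 : Fin L := ⟨p + 1, hp⟩ with hj1
  have h01 : j0 ≠ j1 := by simp [hj0, hj1]
  set y := (weight θ j1 : Matrix (Fin (d (p + 1 + 1))) (Fin (d (p + 1))) ℝ) *ᵥ x with hy
  set y' := ((weight θ j0 : Matrix (Fin (d (p + 1))) (Fin (d p)) ℝ))ᵀ *ᵥ x with hy'
  set δ : Params L d := layerSingle j1 (Matrix.vecMulVec y x) +
    layerSingle j0 (-(Matrix.vecMulVec x y')) with hδ
  have hder : prodVecDeriv hd θ δ = 0 := by
    have := weightProdDeriv_rebalance θ δ p hp (Matrix.vecMulVec x x) ?_ ?_ ?_ L le_rfl hp.ne'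
    · funext b
      rw [prodVecDeriv, this]
      rfl
    · rw [hδ, weight_add, weight_layerSingle_of_ne h01, weight_layerSingle_same,
        Matrix.vecMulVec_mul, ← Matrix.mulVec_transpose, zero_add]
    · rw [hδ, weight_add, weight_layerSingle_of_ne h01.symm, weight_layerSingle_same,
        Matrix.mul_vecMulVec, add_zero]
    · intro j h0 h1
      rw [hδ, weight_add, weight_layerSingle_of_ne, weight_layerSingle_of_ne, add_zero]
      · exact fun h => h0 (by rw [h])
      · exact fun h => h1 (by rw [h])
  have hin := inner_gradient_risk hd hℓ data θ δ
  rw [hder] at hin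
  simp only [zero_dotProduct, mul_zero, Finset.sum_const_zero] at hin
  rw [hδ, inner_add_right, ← Matrix.neg_vecMulVec, inner_layerSingle_vecMulVec,
    inner_layerSingle_vecMulVec, neg_dotProduct] at hin
  have h3 := transpose_mulVec_dotProduct
    (weight (gradient (risk hd ℓ data) θ) j0 : Matrix (Fin (d (p + 1))) (Fin (d p)) ℝ) x y'
  rw [dotProduct_comm] at h3
  refine Eq.trans ?_ h3.symm
  linarith [hin]

end Directions

/-! ### Conservation of balancedness along the flow. -/

section Flow

variable {L : ℕ} {d : ℕ → ℕ}

theorem hasDerivWithinAt_weight_apply {W : ℝ → Params L d} {W' : Params L d} {s : Set ℝ} {t : ℝ}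
    (h : HasDerivWithinAt W W' s t) (j : Fin L) (a : Fin (d (j + 1))) (b : Fin (d j)) :
    HasDerivWithinAt (fun t => weight (W t) j a b) (weight W' j a b) s t :=
  (EuclideanSpace.proj (𝕜 := ℝ)
    (⟨j, (a, b)⟩ : Σ j : Fin L, Fin (d (j + 1)) × Fin (d j))).hasFDerivAt.comp_hasDerivWithinAt t h

theorem hasDerivWithinAt_mulVec_dotProduct_self {m n : ℕ} {M : ℝ → Matrix (Fin m) (Fin n) ℝ}
    {M' : Matrix (Fin m) (Fin n) ℝ} {s : Set ℝ} {t : ℝ}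
    (h : ∀ a b, HasDerivWithinAt (fun t => M t a b) (M' a b) s t) (x : Fin n → ℝ) :
    HasDerivWithinAt (fun t => (M t *ᵥ x) ⬝ᵥ (M t *ᵥ x))
      (2 * ((M t *ᵥ x) ⬝ᵥ (M' *ᵥ x))) s t := by
  have h1 : ∀ a, HasDerivWithinAt (fun t => (M t *ᵥ x) a) ((M' *ᵥ x) a) s t := fun a =>
    HasDerivWithinAt.fun_sum (u := Finset.univ) fun b _ => (h a b).mul_const (x b)
  have h2 : HasDerivWithinAt (fun t => ∑ a, (M t *ᵥ x) a * (M t *ᵥ x) a)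
      (∑ a, ((M' *ᵥ x) a * (M t *ᵥ x) a + (M t *ᵥ x) a * (M' *ᵥ x) a)) s t :=
    HasDerivWithinAt.fun_sum fun a _ => (h1 a).mul (h1 a)
  convert! h2 using 1
  rw [dotProduct, Finset.mul_sum]
  exact Finset.sum_congr rfl fun a _ => by ring

theorem imbalance_eq_initial (hd : d L = 1) {ℓ : ℝ → ℝ} (hℓ : Differentiable ℝ ℓ)
    {k : ℕ} {data : Fin k → LabeledGraph (d 0)} {W : ℝ → Params L d}
    (hflow : IsGradientFlow (risk hd ℓ data) W) (p : ℕ) (hp : p + 1 < L)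
    (x : Fin (d (p + 1)) → ℝ) {t : ℝ} (ht : 0 ≤ t) :
    imbalance (W t) p hp x = imbalance (W 0) p hp x := by
  have key : ∀ s ∈ Ici (0 : ℝ),
      HasDerivWithinAt (fun t => imbalance (W t) p hp x) 0 (Ici 0) s := by
    intro s hs
    have h1 := hasDerivWithinAt_mulVec_dotProduct_self
      (hasDerivWithinAt_weight_apply (hflow s hs) ⟨p + 1, hp⟩) x
    have h0 := hasDerivWithinAt_mulVec_dotProduct_self
      (M := fun t => (weight (W t) ⟨p, Nat.lt_of_succ_lt hp⟩)ᵀ)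
      (M' := (weight (-gradient (risk hd ℓ data) (W s)) ⟨p, Nat.lt_of_succ_lt hp⟩)ᵀ)
      (fun a b => hasDerivWithinAt_weight_apply (hflow s hs) ⟨p, Nat.lt_of_succ_lt hp⟩ b a) x
    have hneg : ∀ (θ : Params L d) j, weight (-θ) j = -weight θ j := fun _ _ => rfl
    have hb := gradient_risk_balanced hd hℓ data (W s) p hp x
    convert! h1.sub h0 using 1
    rw [hneg, hneg, Matrix.transpose_neg, Matrix.neg_mulVec, Matrix.neg_mulVec, dotProduct_neg,
      dotProduct_neg, hb]
    ring
  have := (convex_Ici (0 : ℝ)).norm_image_sub_le_of_norm_hasDerivWithin_le (C := 0) key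
    (by simp) (mem_Ici.2 le_rfl) (mem_Ici.2 ht)
  rw [zero_mul, norm_le_zero_iff, sub_eq_zero] at this
  exact this

/-- Summing the conserved imbalance over the standard basis gives the difference of neighbouring
squared Frobenius norms. -/
theorem norm_sq_weight_sub_eq_initial (hd : d L = 1) {ℓ : ℝ → ℝ} (hℓ : Differentiable ℝ ℓ)
    {k : ℕ} {data : Fin k → LabeledGraph (d 0)} {W : ℝ → Params L d}
    (hflow : IsGradientFlow (risk hd ℓ data) W) {t : ℝ} (ht : 0 ≤ t) (i j : Fin L) :
    ‖weight (W t) i‖ ^ 2 - ‖weight (W 0) i‖ ^ 2 =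
      ‖weight (W t) j‖ ^ 2 - ‖weight (W 0) j‖ ^ 2 := by
  have hsum : ∀ (θ : Params L d) (p : ℕ) (hp : p + 1 < L),
      ‖weight θ ⟨p + 1, hp⟩‖ ^ 2 - ‖weight θ ⟨p, Nat.lt_of_succ_lt hp⟩‖ ^ 2 =
        ∑ b, imbalance θ p hp (Pi.single b 1) := by
    intro θ p hp
    rw [← Matrix.frobenius_norm_transpose (weight θ ⟨p, _⟩),
      frobenius_norm_sq_eq_sum_mulVec, frobenius_norm_sq_eq_sum_mulVec]
    exact (Finset.sum_sub_distrib _ _).symm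
  have h0 : ∀ (p : ℕ) (hp : p < L), ‖weight (W t) ⟨p, hp⟩‖ ^ 2 - ‖weight (W 0) ⟨p, hp⟩‖ ^ 2 =
      ‖weight (W t) ⟨0, by omega⟩‖ ^ 2 - ‖weight (W 0) ⟨0, by omega⟩‖ ^ 2 := by
    intro p
    induction p with
    | zero => intro; rfl
    | succ p ih =>
      intro hp
      have h1 := hsum (W t) p hp
      have h2 := hsum (W 0) p hp
      simp only [imbalance_eq_initial hd hℓ hflow p hp _ ht] at h1
      linarith [ih (by omega)]
  rw [h0 i i.2, h0 j j.2]

end Flow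

end LinearMPNN

/-! ### Growth and energy of an abstract gradient flow. -/

section Descent

variable {E : Type*} [NormedAddCommGroup E] [InnerProductSpace ℝ E]

/-- Along a gradient flow with nonnegative energy the path grows at most like `√T`. -/
theorem gradientFlow_norm_le {W g : ℝ → E} {r : ℝ → ℝ}
    (hW : ∀ t, 0 ≤ t → HasDerivWithinAt W (-g t) (Ici 0) t)
    (hr : ∀ t, 0 ≤ t → HasDerivWithinAt r (-‖g t‖ ^ 2) (Ici 0) t)
    (hpos : ∀ t, 0 ≤ t → 0 ≤ r t) {T t : ℝ} (hT : 1 ≤ T) (ht : t ∈ Icc 0 T) :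
    ‖W t‖ ≤ (‖W 0‖ + r 0 + 1) * √T := by
  have ha : 1 ≤ √T := Real.one_le_sqrt.2 hT
  have ha2 : √T ^ 2 = T := Real.sq_sqrt (by linarith)
  set a := √T
  have hmono : ∀ x ∈ Ico (0 : ℝ) T, Ici x ⊆ Ici (0 : ℝ) := fun x hx => Ici_subset_Ici.2 hx.1
  have hsub : Icc (0 : ℝ) T ⊆ Ici 0 := fun x hx => hx.1
  -- The speed is controlled by `‖g‖ ≤ (a/2) ‖g‖² + 1/(2a)`; the choice `a = √T` makes both
  -- integrated terms of order `√T`.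
  have h := image_norm_le_of_norm_deriv_right_le_deriv_boundary' (a := 0) (b := T) (f := W)
    (f' := fun t => -g t) (B := fun t => ‖W 0‖ + a / 2 * (r 0 - r t) + t / (2 * a))
    (B' := fun t => a / 2 * ‖g t‖ ^ 2 + 1 / (2 * a))
    (fun x hx => ((hW x hx.1).mono hsub).continuousWithinAt)
    (fun x hx => (hW x hx.1).mono (hmono x hx)) (by simp)
    (ContinuousOn.add (continuousOn_const.add (continuousOn_const.mul (continuousOn_const.sub
      fun x hx => ((hr x hx.1).mono hsub).continuousWithinAt))) (by fun_prop))
    (fun x hx => by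
      have h1 := ((((hr x hx.1).mono (hmono x hx)).const_sub (r 0)).const_mul (a / 2)).const_add
        ‖W 0‖
      have h2 := h1.add ((hasDerivWithinAt_id x (Ici x)).div_const (2 * a))
      convert! h2 using 1
      simp)
    (fun x hx => by
      rw [norm_neg]
      have : 0 ≤ (a * ‖g x‖ - 1) ^ 2 / (2 * a) := by positivity
      have e : (a * ‖g x‖ - 1) ^ 2 / (2 * a) = a / 2 * ‖g x‖ ^ 2 + 1 / (2 * a) - ‖g x‖ := by
        field_simp
        ring
      linarith) ht
  have h1 : t / (2 * a) ≤ a := by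
    rw [div_le_iff₀ (by linarith)]
    nlinarith [ht.2]
  have h2 : a / 2 * (r 0 - r t) ≤ a * r 0 := by
    nlinarith [hpos t ht.1, hpos 0 le_rfl, mul_nonneg (by linarith : 0 ≤ a) (hpos t ht.1),
      mul_nonneg (by linarith : 0 ≤ a) (hpos 0 le_rfl)]
  have h3 : ‖W 0‖ ≤ ‖W 0‖ * a := le_mul_of_one_le_right (norm_nonneg _) ha
  calc ‖W t‖ ≤ _ := h
    _ ≤ (‖W 0‖ + r 0 + 1) * a := by linarith

/-- A gradient flow with nonnegative energy cannot keep `‖∇‖ ‖W‖` away from zero. -/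
theorem gradientFlow_not_bounded_below {W g : ℝ → E} {r : ℝ → ℝ}
    (hW : ∀ t, 0 ≤ t → HasDerivWithinAt W (-g t) (Ici 0) t)
    (hr : ∀ t, 0 ≤ t → HasDerivWithinAt r (-‖g t‖ ^ 2) (Ici 0) t)
    (hpos : ∀ t, 0 ≤ t → 0 ≤ r t) {κ t₀ : ℝ} (hκ : 0 < κ)
    (h : ∀ t, t₀ ≤ t → κ ≤ ‖g t‖ ^ 2 * ‖W t‖ ^ 2) : False := by
  set C := ‖W 0‖ + r 0 + 1 with hC
  have hC0 : 0 < C := by linarith [norm_nonneg (W 0), hpos 0 le_rfl]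
  set η := κ / (2 * C ^ 2) with hη
  have hη0 : 0 < η := by positivity
  -- On `[s, 2s]` the growth bound gives `‖W‖² ≤ 2 C² s`, hence `‖g‖² ≥ η / s`; integration over
  -- length `s` costs `η`.
  have hdrop : ∀ s, 1 ≤ s → t₀ ≤ s → r (2 * s) ≤ r s - η := by
    intro s hs1 hs0
    have hb := image_le_of_deriv_right_le_deriv_boundary (a := s) (b := 2 * s) (f := r)
      (f' := fun t => -‖g t‖ ^ 2) (B := fun t => r s - η / s * (t - s))
      (B' := fun _ => -(η / s))
      (fun x hx => ((hr x (by linarith [hx.1])).mono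
        (fun y hy => le_trans (by linarith) hy.1 : Icc s (2 * s) ⊆ Ici 0)).continuousWithinAt)
      (fun x hx => (hr x (by linarith [hx.1])).mono (Ici_subset_Ici.2 (by linarith [hx.1])))
      (by simp) (by fun_prop)
      (fun x _ => by
        have := (((hasDerivWithinAt_id x (Ici x)).sub_const s).const_mul (η / s)).const_sub (r s)
        simpa using this)
      (fun x hx => by
        have h1 := gradientFlow_norm_le hW hr hpos (T := 2 * s) (t := x) (by linarith)
          ⟨by linarith [hx.1], hx.2.le⟩
        have h2 : ‖W x‖ ^ 2 ≤ C ^ 2 * (2 * s) := by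
          have := pow_le_pow_left₀ (norm_nonneg _) h1 2
          rwa [mul_pow, Real.sq_sqrt (by linarith)] at this
        have h3 := (h x (hs0.trans hx.1)).trans (mul_le_mul_of_nonneg_left h2 (sq_nonneg ‖g x‖))
        have h4 : η / s ≤ ‖g x‖ ^ 2 := by
          rw [hη, div_div, div_le_iff₀ (by positivity)]
          linarith
        linarith) (right_mem_Icc.2 (by linarith))
    have e : η / s * (2 * s - s) = η := by
      field_simp
      ring
    linarith
  set s := max 1 t₀
  have hs1 : 1 ≤ s := le_max_left _ _
  have hit : ∀ n : ℕ, r (2 ^ n * s) ≤ r s - n * η := by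
    intro n
    induction n with
    | zero => simp
    | succ n ih =>
      have hge : s ≤ 2 ^ n * s :=
        le_mul_of_one_le_left (by linarith) (one_le_pow₀ (by norm_num))
      have h1 := hdrop (2 ^ n * s) (hs1.trans hge) ((le_max_right _ _).trans hge)
      rw [← mul_assoc, ← pow_succ'] at h1
      push_cast
      linarith
  obtain ⟨n, hn⟩ := exists_nat_gt (r s / η)
  rw [div_lt_iff₀ hη0] at hn
  have := hpos (2 ^ n * s) (by positivity)
  linarith [hit n]

end Descent

namespace LinearMPNN

/-! ### The risk as a function of the linear predictor. -/

section LinearRisk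

variable {ℓ : ℝ → ℝ}

theorem LossAssumption.strictAnti (h : LossAssumption ℓ) : StrictAnti ℓ :=
  strictAnti_of_deriv_neg h.deriv_neg

theorem LossAssumption.differentiable (h : LossAssumption ℓ) : Differentiable ℝ ℓ :=
  h.contDiff.differentiable one_ne_zero

variable {k n : ℕ} {z : Fin k → Fin n → ℝ}

theorem continuous_linearRisk (h : LossAssumption ℓ) : Continuous (linearRisk ℓ z) := by
  unfold linearRisk
  refine continuous_const.mul (continuous_finsetSum _ fun i _ =>
    h.differentiable.continuous.comp ?_)
  exact continuous_id.dotProduct continuous_const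

theorem linearRisk_nonneg (h : LossAssumption ℓ) (w : Fin n → ℝ) : 0 ≤ linearRisk ℓ z w :=
  mul_nonneg (by positivity) (Finset.sum_nonneg fun i _ => (h.pos _).le)

theorem loss_le_mul_linearRisk (h : LossAssumption ℓ) (w : Fin n → ℝ) (i : Fin k) :
    ℓ (w ⬝ᵥ z i) ≤ k * linearRisk ℓ z w := by
  have hk : (k : ℝ) ≠ 0 := by
    have := i.pos
    positivity
  rw [linearRisk, ← mul_assoc, mul_one_div_cancel hk, one_mul]
  exact Finset.single_le_sum (f := fun i => ℓ (w ⬝ᵥ z i)) (fun _ _ => (h.pos _).le)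
    (Finset.mem_univ i)

theorem exists_linearRisk_le_loss (hk : 0 < k) (w : Fin n → ℝ) :
    ∃ i, linearRisk ℓ z w ≤ ℓ (w ⬝ᵥ z i) := by
  have : Nonempty (Fin k) := ⟨⟨0, hk⟩⟩
  obtain ⟨i, hi⟩ := Finite.exists_max fun i => ℓ (w ⬝ᵥ z i)
  refine ⟨i, ?_⟩
  have h1 : ∑ j, ℓ (w ⬝ᵥ z j) ≤ k * ℓ (w ⬝ᵥ z i) := by
    simpa using Finset.sum_le_sum fun j (_ : j ∈ Finset.univ) => hi j
  rw [linearRisk, one_div, inv_mul_le_iff₀ (by positivity)]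
  exact h1

/-- On a slab of risk values the derivative of the risk along a separating direction is bounded
away from zero. -/
theorem exists_pos_le_slope (h : LossAssumption ℓ) (hk : 0 < k) {ubar : Fin n → ℝ}
    (hsep : ∀ i, 0 < ubar ⬝ᵥ z i) {ε B : ℝ} (hε : 0 < ε) :
    ∃ c, 0 < c ∧ ∀ w, ε ≤ linearRisk ℓ z w → linearRisk ℓ z w ≤ B →
      c ≤ (1 / (k : ℝ)) * ∑ i, -deriv ℓ (w ⬝ᵥ z i) * (ubar ⬝ᵥ z i) := by
  have : Nonempty (Fin k) := ⟨⟨0, hk⟩⟩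
  obtain ⟨i₀, hi₀⟩ := Finite.exists_min fun i => ubar ⬝ᵥ z i
  -- An example with at least average loss has loss between `ε` and `k * B`, so its margin lies in
  -- the compact interval `[a, b]`, where `-deriv ℓ` has a positive minimum.
  obtain ⟨a, ha⟩ := (h.tendsto_atBot.eventually_gt_atTop (k * B)).exists
  obtain ⟨b, hb⟩ := (h.tendsto_atTop.eventually_lt_const hε).exists
  have hcont : Continuous fun x => -deriv ℓ x := (h.contDiff.continuous_deriv le_rfl).neg
  obtain ⟨δ, hδ, hδle⟩ : ∃ δ, 0 < δ ∧ ∀ x ∈ Icc a b, δ ≤ -deriv ℓ x := by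
    rcases (Icc a b).eq_empty_or_nonempty with he | hne
    · exact ⟨1, one_pos, by simp [he]⟩
    · obtain ⟨x, -, hx⟩ := isCompact_Icc.exists_isMinOn hne hcont.continuousOn
      exact ⟨-deriv ℓ x, by linarith [h.deriv_neg x], fun y hy => hx hy⟩
  refine ⟨(1 / (k : ℝ)) * (δ * (ubar ⬝ᵥ z i₀)), ?_, fun w hw hwB => ?_⟩
  · have := hsep i₀
    positivity
  obtain ⟨i, hi⟩ := exists_linearRisk_le_loss (ℓ := ℓ) (z := z) hk w
  have hmem : w ⬝ᵥ z i ∈ Icc a b := by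
    constructor
    · refine (h.strictAnti.lt_iff_gt.1 ?_).le
      exact (loss_le_mul_linearRisk h w i).trans_lt
        ((mul_le_mul_of_nonneg_left hwB (by positivity)).trans_lt ha)
    · exact (h.strictAnti.lt_iff_gt.1 (hb.trans_le (hw.trans hi))).le
  have hterm : ∀ j, 0 ≤ -deriv ℓ (w ⬝ᵥ z j) * (ubar ⬝ᵥ z j) := fun j =>
    mul_nonneg (by linarith [h.deriv_neg (w ⬝ᵥ z j)]) (hsep j).le
  refine mul_le_mul_of_nonneg_left ?_ (by positivity)
  calc δ * (ubar ⬝ᵥ z i₀) ≤ -deriv ℓ (w ⬝ᵥ z i) * (ubar ⬝ᵥ z i) :=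
        mul_le_mul (hδle _ hmem) (hi₀ i) (hsep i₀).le (hδ.le.trans (hδle _ hmem))
    _ ≤ _ := Finset.single_le_sum (fun j _ => hterm j) (Finset.mem_univ i)

theorem exists_pos_le_dotProduct_self (h : LossAssumption ℓ) {b : ℝ} (hb : b < linearRisk ℓ z 0) :
    ∃ c, 0 < c ∧ ∀ w, linearRisk ℓ z w ≤ b → c ≤ w ⬝ᵥ w := by
  have h1 : ∀ᶠ w in 𝓝 (0 : Fin n → ℝ), b < linearRisk ℓ z w :=
    (continuous_linearRisk h).continuousAt.eventually (lt_mem_nhds hb)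
  obtain ⟨ρ, hρ, hball⟩ := Metric.eventually_nhds_iff.1 h1
  refine ⟨ρ ^ 2, by positivity, fun w hw => ?_⟩
  by_contra! hlt
  refine (hball ?_).not_ge hw
  rw [dist_zero_right, pi_norm_lt_iff hρ]
  intro i
  rw [Real.norm_eq_abs, ← sq_lt_sq₀ (abs_nonneg _) hρ.le, sq_abs, sq]
  exact (Finset.single_le_sum (f := fun i => w i * w i) (fun _ _ => mul_self_nonneg _)
    (Finset.mem_univ i)).trans_lt hlt

end LinearRisk

end LinearMPNN

namespace LinearMPNN

/-! ### Vanishing risk and diverging weights. -/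

section RiskConvergence

variable {L : ℕ} {d : ℕ → ℕ} {k : ℕ} {data : Fin k → LabeledGraph (d 0)} {ℓ : ℝ → ℝ}
  {W : ℝ → Params L d}

theorem pos_card_of_gradient_ne_zero (hd : d L = 1) {θ : Params L d}
    (h : gradient (risk hd ℓ data) θ ≠ 0) : 0 < k := by
  rcases Nat.eq_zero_or_pos k with rfl | hk
  · exact absurd (by
      have : risk hd ℓ data = fun _ => 0 := by
        funext θ
        simp [risk]
      rw [this, gradient_fun_const]) h
  · exact hk

theorem hasDerivWithinAt_risk (hd : d L = 1) (hℓ : Differentiable ℝ ℓ)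
    (hflow : IsGradientFlow (risk hd ℓ data) W) {t : ℝ} (ht : 0 ≤ t) :
    HasDerivWithinAt (fun t => risk hd ℓ data (W t))
      (-‖gradient (risk hd ℓ data) (W t)‖ ^ 2) (Ici 0) t := by
  have h := ((differentiable_risk hd hℓ data) (W t)).hasFDerivAt.comp_hasDerivWithinAt t
    (hflow t ht)
  convert! h using 1
  rw [map_neg, ← inner_gradient_left, real_inner_self_eq_norm_sq]

theorem antitoneOn_risk (hd : d L = 1) (hℓ : Differentiable ℝ ℓ)
    (hflow : IsGradientFlow (risk hd ℓ data) W) :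
    AntitoneOn (fun t => risk hd ℓ data (W t)) (Ici 0) := by
  refine antitoneOn_of_hasDerivWithinAt_nonpos (convex_Ici 0)
    (f' := fun t => -‖gradient (risk hd ℓ data) (W t)‖ ^ 2)
    (fun t ht => (hasDerivWithinAt_risk hd hℓ hflow ht).continuousWithinAt)
    (fun t ht => ?_) (fun t _ => by simp)
  exact (hasDerivWithinAt_risk hd hℓ hflow (interior_subset ht)).mono interior_subset

/-- Otherwise the risk would be constant, forcing its one-sided derivative `-‖∇R‖²` at time `0` to
vanish. The strict drop matters when the initial risk equals the risk at zero. -/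
theorem exists_risk_lt_initial (hd : d L = 1) (hℓ : Differentiable ℝ ℓ)
    (hflow : IsGradientFlow (risk hd ℓ data) W)
    (hgrad : gradient (risk hd ℓ data) (W 0) ≠ 0) :
    ∃ t, 0 ≤ t ∧ risk hd ℓ data (W t) < risk hd ℓ data (W 0) := by
  by_contra! hcon
  have hd0 := hasDerivWithinAt_risk hd hℓ hflow le_rfl
  have hconst : HasDerivWithinAt (fun t => risk hd ℓ data (W t)) 0 (Ici 0) 0 := by
    refine (hasDerivWithinAt_const (0 : ℝ) (Ici 0) (risk hd ℓ data (W 0))).congr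
      (fun t ht => ?_) rfl
    exact le_antisymm (antitoneOn_risk hd hℓ hflow (mem_Ici.2 le_rfl) ht ht) (hcon t ht)
  have := (uniqueDiffOn_Ici (0 : ℝ) 0 (mem_Ici.2 le_rfl)).eq_deriv _ hd0 hconst
  rw [neg_eq_zero, sq_eq_zero_iff, norm_eq_zero] at this
  exact hgrad this

theorem prodVec_zero (hL : 0 < L) (hd : d L = 1) : prodVec hd (0 : Params L d) = 0 := by
  obtain ⟨m, rfl⟩ : ∃ m, L = m + 1 := ⟨L - 1, by omega⟩
  have h : weight (0 : Params (m + 1) d) ⟨m, Nat.lt_succ_self m⟩ = 0 := rfl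
  funext b
  rw [prodVec_apply, weightProd, h, Matrix.zero_mul]
  rfl

theorem tendsto_risk_zero (hL : 0 < L) (hd : d L = 1) (hsep : Separable L data)
    (hℓ : LossAssumption ℓ) (hflow : IsGradientFlow (risk hd ℓ data) W)
    (hgrad : gradient (risk hd ℓ data) (W 0) ≠ 0)
    (hinit : risk hd ℓ data (W 0) ≤ risk hd ℓ data 0) :
    Tendsto (fun t => risk hd ℓ data (W t)) atTop (𝓝 0) := by
  have hk := pos_card_of_gradient_ne_zero hd hgrad
  have hdiff := hℓ.differentiable
  have hanti := antitoneOn_risk hd hdiff hflow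
  have hnn : ∀ θ, 0 ≤ risk hd ℓ data θ := fun θ => by
    rw [risk_eq_linearRisk]
    exact linearRisk_nonneg hℓ _
  suffices hsmall : ∀ ε > 0, ∃ t, 0 ≤ t ∧ risk hd ℓ data (W t) < ε by
    rw [Metric.tendsto_atTop]
    intro ε hε
    obtain ⟨t, ht, htε⟩ := hsmall ε hε
    refine ⟨t, fun s hs => ?_⟩
    rw [Real.dist_0_eq_abs, abs_of_nonneg (hnn _)]
    exact (hanti (mem_Ici.2 ht) (mem_Ici.2 (ht.trans hs)) hs).trans_lt htε
  intro ε hε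
  by_contra! hcon
  obtain ⟨t₀, ht₀, hlt⟩ := exists_risk_lt_initial hd hdiff hflow hgrad
  obtain ⟨ubar, hubar⟩ := hsep
  have hubar' : ∀ i, 0 < ubar ⬝ᵥ effectiveInput L (data i) := fun i => by
    rw [effectiveInput, dotProduct_smul]
    exact hubar i
  obtain ⟨c, hc, hslope⟩ := exists_pos_le_slope hℓ hk hubar' hε (B := risk hd ℓ data (W t₀))
  have hlt0 : risk hd ℓ data (W t₀) <
      linearRisk ℓ (fun i => effectiveInput L (data i)) 0 := by
    rw [← prodVec_zero hL hd, ← risk_eq_linearRisk]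
    exact hlt.trans_le hinit
  obtain ⟨b, hb, hbw⟩ := exists_pos_le_dotProduct_self hℓ hlt0
  have hu0 : 0 < ubar ⬝ᵥ ubar := by
    refine (dotProduct_self_nonneg_real ubar).lt_of_ne fun h0 => ?_
    have h1 := dotProduct_sq_le ubar (effectiveInput L (data ⟨0, hk⟩))
    rw [← h0, zero_mul] at h1
    have := hubar' ⟨0, hk⟩
    nlinarith
  refine gradientFlow_not_bounded_below (t₀ := t₀) (κ := c ^ 2 * b / (ubar ⬝ᵥ ubar)) hflow
    (fun t ht => hasDerivWithinAt_risk hd hdiff hflow ht) (fun t _ => hnn _) (by positivity)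
    fun t ht => ?_
  have h0t : 0 ≤ t := ht₀.trans ht
  have hle : risk hd ℓ data (W t) ≤ risk hd ℓ data (W t₀) := hanti ht₀ h0t ht
  have hge := hcon t h0t
  rw [risk_eq_linearRisk] at hge
  have hle' := hle
  rw [risk_eq_linearRisk hd ℓ data (W t)] at hle'
  have hmain := prodVec_dotProduct_le hL hd hdiff data (W t) ubar hc.le (hslope _ hge hle')
  rw [div_le_iff₀ hu0]
  exact (mul_le_mul_of_nonneg_left (hbw _ hle') (sq_nonneg c)).trans hmain

theorem weightProd_mulVec_le (θ : Params L d) {K : ℝ} (hK : ∀ j, ‖weight θ j‖ ^ 2 ≤ K)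
    (m : ℕ) (h : m ≤ L) (x : Fin (d 0) → ℝ) :
    (weightProd θ m h *ᵥ x) ⬝ᵥ (weightProd θ m h *ᵥ x) ≤ K ^ m * (x ⬝ᵥ x) := by
  induction m with
  | zero => simp [weightProd]
  | succ m ih =>
    have hK0 : 0 ≤ K := (sq_nonneg _).trans (hK ⟨m, h⟩)
    rw [weightProd, ← Matrix.mulVec_mulVec, pow_succ', mul_assoc]
    exact (mulVec_dotProduct_self_le _ _).trans (mul_le_mul (hK ⟨m, h⟩) (ih _)
      (dotProduct_self_nonneg_real _) hK0)

/-- Vanishing risk drives the margin of any one example to infinity. That margin is bounded in terms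
of the layer norms, which all grow together, so no layer can stay bounded. -/
theorem tendsto_norm_sq_weight (hL : 0 < L) (hd : d L = 1) (hsep : Separable L data)
    (hℓ : LossAssumption ℓ) (hflow : IsGradientFlow (risk hd ℓ data) W)
    (hgrad : gradient (risk hd ℓ data) (W 0) ≠ 0)
    (hinit : risk hd ℓ data (W 0) ≤ risk hd ℓ data 0) (j : Fin L) :
    Tendsto (fun t => ‖weight (W t) j‖ ^ 2) atTop atTop := by
  have hk := pos_card_of_gradient_ne_zero hd hgrad
  have hrisk := tendsto_risk_zero hL hd hsep hℓ hflow hgrad hinit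
  set z := effectiveInput L (data ⟨0, hk⟩) with hz
  set C := ∑ i, ‖weight (W 0) i‖ ^ 2 with hC
  have hbound : ∀ t, 0 ≤ t → (prodVec hd (W t) ⬝ᵥ z) ^ 2 ≤
      (‖weight (W t) j‖ ^ 2 + C) ^ L * (z ⬝ᵥ z) := by
    intro t ht
    refine le_trans ?_ (weightProd_mulVec_le (W t) (fun i => ?_) L le_rfl z)
    · rw [sq]
      exact Finset.single_le_sum
        (f := fun a => (weightProd (W t) L le_rfl *ᵥ z) a * (weightProd (W t) L le_rfl *ᵥ z) a)
        (fun _ _ => mul_self_nonneg _) (Finset.mem_univ (outIdx hd))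
    · have h1 := norm_sq_weight_sub_eq_initial hd hℓ.differentiable hflow ht i j
      have h2 : ‖weight (W 0) i‖ ^ 2 ≤ C :=
        Finset.single_le_sum (f := fun i => ‖weight (W 0) i‖ ^ 2) (fun _ _ => sq_nonneg _)
          (Finset.mem_univ i)
      linarith [sq_nonneg ‖weight (W 0) j‖]
  have hC0 : 0 ≤ C := Finset.sum_nonneg fun _ _ => sq_nonneg _
  rw [tendsto_atTop]
  intro M
  -- If the squared norm were below `M`, the squared margin would be at most `N`, contradicting a
  -- margin above `N + 1`.
  set N := (|M| + C) ^ L * (z ⬝ᵥ z) with hN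
  have hN0 : 0 ≤ N := mul_nonneg (by positivity) (dotProduct_self_nonneg_real z)
  have hev : ∀ᶠ t in atTop, k * risk hd ℓ data (W t) < ℓ (N + 1) := by
    have := hrisk.const_mul (k : ℝ)
    rw [mul_zero] at this
    exact this.eventually_lt_const (hℓ.pos _)
  filter_upwards [hev, eventually_ge_atTop 0] with t h1 ht
  by_contra! hlt
  have h2 : ℓ (prodVec hd (W t) ⬝ᵥ z) < ℓ (N + 1) := by
    refine (loss_le_mul_linearRisk (z := fun i => effectiveInput L (data i)) hℓ _
      ⟨0, hk⟩).trans_lt ?_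
    rwa [risk_eq_linearRisk] at h1
  have h3 := hℓ.strictAnti.lt_iff_gt.1 h2
  have h4 : (‖weight (W t) j‖ ^ 2 + C) ^ L * (z ⬝ᵥ z) ≤ N := by
    refine mul_le_mul_of_nonneg_right (pow_le_pow_left₀ (by positivity) ?_ _)
      (dotProduct_self_nonneg_real z)
    linarith [le_abs_self M]
  nlinarith [hbound t ht]

end RiskConvergence

/-! ### Rank-one limits and alignment of adjacent layers. -/

section Alignment

variable {L : ℕ} {d : ℕ → ℕ} {k : ℕ} {data : Fin k → LabeledGraph (d 0)} {ℓ : ℝ → ℝ}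
  {W : ℝ → Params L d} {u : (j : Fin L) → ℝ → Fin (d (j + 1)) → ℝ}
  {v : (j : Fin L) → ℝ → Fin (d j) → ℝ}

theorem norm_sq_le_topSing_sq_of_one_row {m n : ℕ} (hm : m = 1)
    (M : Matrix (Fin m) (Fin n) ℝ) : ‖M‖ ^ 2 ≤ topSing M ^ 2 := by
  subst hm
  have h := transpose_mulVec_dotProduct_self_le_topSing M (Pi.single 0 1)
  rw [← Matrix.frobenius_norm_transpose, frobenius_norm_sq_eq_sum_mulVec]
  simpa using h

/-- The defect of layer `p` from having rank one is at most that of layer `p + 1`, up to a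
constant. -/
theorem topSing_sq_succ_le (hd : d L = 1) (hℓ : Differentiable ℝ ℓ)
    (hflow : IsGradientFlow (risk hd ℓ data) W)
    (huv : ∀ (j : Fin L) (t : ℝ), 0 ≤ t → IsTopSingularPair (weight (W t) j) (u j t) (v j t))
    (p : ℕ) (hp : p + 1 < L) {t : ℝ} (ht : 0 ≤ t) :
    topSing (weight (W t) ⟨p + 1, hp⟩) ^ 2 - ‖weight (W 0) ⟨p + 1, hp⟩‖ ^ 2 ≤
      ((weight (W t) ⟨p, Nat.lt_of_succ_lt hp⟩)ᵀ *ᵥ v ⟨p + 1, hp⟩ t) ⬝ᵥ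
        ((weight (W t) ⟨p, Nat.lt_of_succ_lt hp⟩)ᵀ *ᵥ v ⟨p + 1, hp⟩ t) := by
  have hpair := huv ⟨p + 1, hp⟩ t ht
  -- Conservation holds for each fixed test vector, so it may be used with the singular vector at
  -- time `t`; no regularity of `v` in time is needed.
  have h1 := imbalance_eq_initial hd hℓ hflow p hp (v ⟨p + 1, hp⟩ t) ht
  rw [imbalance, imbalance, hpair.mulVec_dotProduct_self] at h1
  have h2 := mulVec_dotProduct_self_le (weight (W 0) ⟨p + 1, hp⟩) (v ⟨p + 1, hp⟩ t)
  rw [hpair.2.1, mul_one] at h2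
  have h3 := dotProduct_self_nonneg_real
    ((weight (W 0) ⟨p, Nat.lt_of_succ_lt hp⟩)ᵀ *ᵥ v ⟨p + 1, hp⟩ t)
  linarith

/-- Descending induction from the output layer, whose single row gives defect zero; `n` counts the
layers above `p`. Passing down one layer costs only a constant from the initialization. -/
theorem exists_norm_sq_sub_topSing_sq_le (hd : d L = 1) (hℓ : Differentiable ℝ ℓ)
    (hflow : IsGradientFlow (risk hd ℓ data) W)
    (huv : ∀ (j : Fin L) (t : ℝ), 0 ≤ t → IsTopSingularPair (weight (W t) j) (u j t) (v j t))
    (j : Fin L) :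
    ∃ C, ∀ t, 0 ≤ t → ‖weight (W t) j‖ ^ 2 - topSing (weight (W t) j) ^ 2 ≤ C := by
  suffices h : ∀ (n p : ℕ) (hp : p < L), p + n + 1 = L → ∃ C, ∀ t, 0 ≤ t →
      ‖weight (W t) ⟨p, hp⟩‖ ^ 2 - topSing (weight (W t) ⟨p, hp⟩) ^ 2 ≤ C from
    h (L - 1 - j) j j.2 (by omega)
  intro n
  induction n with
  | zero =>
    intro p hp hpL
    have h1 : d (p + 1) = 1 := by rwa [show p + 1 = L by omega]
    exact ⟨0, fun t _ => sub_nonpos.2 (norm_sq_le_topSing_sq_of_one_row h1 _)⟩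
  | succ n ih =>
    intro p hp hpL
    have hp' : p + 1 < L := by omega
    obtain ⟨C, hC⟩ := ih (p + 1) hp' (by omega)
    refine ⟨C + ‖weight (W 0) ⟨p, hp⟩‖ ^ 2, fun t ht => ?_⟩
    have h1 := topSing_sq_succ_le hd hℓ hflow huv p hp' ht
    have h2 := transpose_mulVec_dotProduct_self_le_topSing (weight (W t) ⟨p, hp⟩)
      (v ⟨p + 1, hp'⟩ t)
    rw [(huv ⟨p + 1, hp'⟩ t ht).2.1, mul_one] at h2
    have h3 := norm_sq_weight_sub_eq_initial hd hℓ hflow ht ⟨p, hp⟩ ⟨p + 1, hp'⟩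
    linarith [hC t ht]

theorem tendsto_one_of_sq_lower_bound {f q : ℝ → ℝ} {C : ℝ} (hq : Tendsto q atTop atTop)
    (h0 : ∀ᶠ t in atTop, 0 ≤ f t) (h1 : ∀ᶠ t in atTop, f t ≤ 1)
    (h : ∀ᶠ t in atTop, q t - C ≤ q t * f t ^ 2) : Tendsto f atTop (𝓝 1) := by
  have hlow : Tendsto (fun t => 1 - C / q t) atTop (𝓝 1) := by
    simpa using (hq.const_div_atTop C).const_sub 1
  refine tendsto_of_tendsto_of_tendsto_of_le_of_le' hlow tendsto_const_nhds ?_ h1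
  filter_upwards [h0, h1, h, hq.eventually_gt_atTop 0] with t h0 h1 h hqt
  have h2 : 1 - C / q t ≤ f t ^ 2 := by
    rw [one_sub_div hqt.ne', div_le_iff₀ hqt]
    linarith
  nlinarith

theorem tendsto_topSing_div_norm (hL : 0 < L) (hd : d L = 1) (hsep : Separable L data)
    (hℓ : LossAssumption ℓ) (hflow : IsGradientFlow (risk hd ℓ data) W)
    (hgrad : gradient (risk hd ℓ data) (W 0) ≠ 0)
    (hinit : risk hd ℓ data (W 0) ≤ risk hd ℓ data 0)
    (huv : ∀ (j : Fin L) (t : ℝ), 0 ≤ t → IsTopSingularPair (weight (W t) j) (u j t) (v j t))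
    (j : Fin L) :
    Tendsto (fun t => topSing (weight (W t) j) / ‖weight (W t) j‖) atTop (𝓝 1) := by
  have hq := tendsto_norm_sq_weight hL hd hsep hℓ hflow hgrad hinit j
  obtain ⟨C, hC⟩ := exists_norm_sq_sub_topSing_sq_le hd hℓ.differentiable hflow huv j
  refine tendsto_one_of_sq_lower_bound (C := C) hq
    (Eventually.of_forall fun t => div_nonneg (topSing_nonneg _) (norm_nonneg _)) ?_ ?_
  · filter_upwards [eventually_ge_atTop 0] with t ht
    exact div_le_one_of_le₀ (huv j t ht).topSing_le (norm_nonneg _)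
  · filter_upwards [eventually_ge_atTop 0, hq.eventually_gt_atTop 0] with t ht hpos
    rw [div_pow, mul_div_cancel₀ _ hpos.ne']
    linarith [hC t ht]

/-- Balancedness bounds `|W_pᵀ v_{p+1}|²` below by `‖W_p‖²` minus a constant, while
`IsTopSingularPair.transpose_mulVec_le` bounds it above by `‖W_p‖² (u_p ⬝ᵥ v_{p+1})²` plus a
constant. -/
theorem tendsto_abs_dotProduct_adjacent (hL : 0 < L) (hd : d L = 1) (hsep : Separable L data)
    (hℓ : LossAssumption ℓ) (hflow : IsGradientFlow (risk hd ℓ data) W)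
    (hgrad : gradient (risk hd ℓ data) (W 0) ≠ 0)
    (hinit : risk hd ℓ data (W 0) ≤ risk hd ℓ data 0)
    (huv : ∀ (j : Fin L) (t : ℝ), 0 ≤ t → IsTopSingularPair (weight (W t) j) (u j t) (v j t))
    (p : ℕ) (hp : p + 1 < L) :
    Tendsto (fun t => |u ⟨p, Nat.lt_of_succ_lt hp⟩ t ⬝ᵥ v ⟨p + 1, hp⟩ t|) atTop (𝓝 1) := by
  set i : Fin L := ⟨p, Nat.lt_of_succ_lt hp⟩ with hi
  have hq := tendsto_norm_sq_weight hL hd hsep hℓ hflow hgrad hinit i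
  obtain ⟨C, hC⟩ := exists_norm_sq_sub_topSing_sq_le hd hℓ.differentiable hflow huv i
  obtain ⟨C', hC'⟩ :=
    exists_norm_sq_sub_topSing_sq_le hd hℓ.differentiable hflow huv ⟨p + 1, hp⟩
  refine tendsto_one_of_sq_lower_bound (C := C + C' + ‖weight (W 0) i‖ ^ 2) hq
    (Eventually.of_forall fun t => abs_nonneg _) ?_ ?_
  · filter_upwards [eventually_ge_atTop 0] with t ht
    have := dotProduct_sq_le (u i t) (v ⟨p + 1, hp⟩ t)
    rw [(huv i t ht).1, (huv ⟨p + 1, hp⟩ t ht).2.1, mul_one] at this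
    exact (sq_le_one_iff_abs_le_one _).1 this
  · filter_upwards [eventually_ge_atTop 0] with t ht
    rw [sq_abs]
    have h1 := topSing_sq_succ_le hd hℓ.differentiable hflow huv p hp ht
    have h2 := (huv i t ht).transpose_mulVec_le (v ⟨p + 1, hp⟩ t) (huv ⟨p + 1, hp⟩ t ht).2.1
    have h3 := norm_sq_weight_sub_eq_initial hd hℓ.differentiable hflow ht i ⟨p + 1, hp⟩
    have h4 := mul_le_mul_of_nonneg_right (huv i t ht).topSing_sq_le
      (sq_nonneg (u i t ⬝ᵥ v ⟨p + 1, hp⟩ t))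
    have h5 := h1.trans h2
    linarith [hC t ht, hC' t ht]

/-- The parameters with every weight matrix scaled to Frobenius norm one. -/
noncomputable def normalized (θ : Params L d) : Params L d := ofWeights fun j => ‖weight θ j‖⁻¹ • weight θ j

theorem weight_normalized (θ : Params L d) (j : Fin L) :
    weight (normalized θ) j = ‖weight θ j‖⁻¹ • weight θ j := weight_ofWeights _ j

theorem norm_sq_weight_normalized_le (θ : Params L d) (j : Fin L) :
    ‖weight (normalized θ) j‖ ^ 2 ≤ 1 := by
  rw [weight_normalized, norm_smul, norm_inv, norm_norm]
  exact pow_le_one₀ (by positivity) inv_mul_le_one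

theorem weightProd_normalized (θ : Params L d) (m : ℕ) (h : m ≤ L) :
    weightProd (normalized θ) m h =
      (∏ j : Fin m, ‖weight θ (j.castLE h)‖)⁻¹ • weightProd θ m h := by
  induction m with
  | zero => simp [weightProd]
  | succ m ih =>
    rw [weightProd, ih, weight_normalized, weightProd, Fin.prod_univ_castSucc, Matrix.smul_mul,
      Matrix.mul_smul, smul_smul, mul_inv, mul_comm]
    rfl

theorem IsTopSingularPair.dotProduct_smul_mulVec {m n : ℕ} {M : Matrix (Fin m) (Fin n) ℝ}
    {u : Fin m → ℝ} {v : Fin n → ℝ} (h : IsTopSingularPair M u v) (x : Fin n → ℝ) :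
    u ⬝ᵥ ((‖M‖⁻¹ • M) *ᵥ x) = topSing M / ‖M‖ * (v ⬝ᵥ x) := by
  rw [Matrix.smul_mulVec, dotProduct_smul, ← transpose_mulVec_dotProduct, h.2.2.2,
    smul_dotProduct, smul_eq_mul, smul_eq_mul, topSing]
  ring

/-- Pairing with the left singular vector replaces the outermost normalized layer by the factor `σ /
‖W‖` and its right singular vector, which is asymptotically `±` the left singular vector one layer
below. -/
theorem tendsto_abs_dotProduct_weightProd (hL : 0 < L) (hd : d L = 1) (hsep : Separable L data)
    (hℓ : LossAssumption ℓ) (hflow : IsGradientFlow (risk hd ℓ data) W)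
    (hgrad : gradient (risk hd ℓ data) (W 0) ≠ 0)
    (hinit : risk hd ℓ data (W 0) ≤ risk hd ℓ data 0)
    (huv : ∀ (j : Fin L) (t : ℝ), 0 ≤ t → IsTopSingularPair (weight (W t) j) (u j t) (v j t))
    (m : ℕ) (h : m < L) :
    Tendsto (fun t => |u ⟨m, h⟩ t ⬝ᵥ
      (weightProd (normalized (W t)) (m + 1) h *ᵥ v ⟨0, hL⟩ t)|) atTop (𝓝 1) := by
  induction m with
  | zero =>
    have h1 := (tendsto_topSing_div_norm hL hd hsep hℓ hflow hgrad hinit huv ⟨0, hL⟩).abs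
    rw [abs_one] at h1
    refine h1.congr' ?_
    filter_upwards [eventually_ge_atTop 0] with t ht
    rw [weightProd, weightProd, Matrix.mul_one, weight_normalized,
      (huv ⟨0, hL⟩ t ht).dotProduct_smul_mulVec, (huv ⟨0, hL⟩ t ht).2.1, mul_one]
  | succ m ih =>
    have ih := ih (Nat.lt_of_succ_lt h)
    have hadj := tendsto_abs_dotProduct_adjacent hL hd hsep hℓ hflow hgrad hinit huv m h
    set x : ℝ → Fin (d (m + 1)) → ℝ := fun t =>
      weightProd (normalized (W t)) (m + 1) h.le *ᵥ v ⟨0, hL⟩ t with hx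
    have hx1 : ∀ t, 0 ≤ t → x t ⬝ᵥ x t ≤ 1 := fun t ht => by
      have := weightProd_mulVec_le (normalized (W t)) (norm_sq_weight_normalized_le (W t))
        (m + 1) h.le (v ⟨0, hL⟩ t)
      rwa [(huv ⟨0, hL⟩ t ht).2.1, one_pow, mul_one] at this
    have hvx : Tendsto (fun t => |v ⟨m + 1, h⟩ t ⬝ᵥ x t|) atTop (𝓝 1) := by
      -- This is the lower bound of `abs_dotProduct_lower_bound`; its error term vanishes by the
      -- induction hypothesis.
      have hlow := (ih.mul hadj).sub (((ih.pow 2).const_sub 1).sqrt)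
      rw [one_pow, sub_self, Real.sqrt_zero, one_mul, sub_zero] at hlow
      refine tendsto_of_tendsto_of_tendsto_of_le_of_le' hlow tendsto_const_nhds ?_ ?_
      · filter_upwards [eventually_ge_atTop 0] with t ht
        have := abs_dotProduct_lower_bound (u ⟨m, Nat.lt_of_succ_lt h⟩ t) (v ⟨m + 1, h⟩ t) (x t)
          (huv _ t ht).1 (huv _ t ht).2.1 (hx1 t ht)
        rwa [← sq_abs] at this
      · filter_upwards [eventually_ge_atTop 0] with t ht
        have := dotProduct_sq_le (v ⟨m + 1, h⟩ t) (x t)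
        rw [(huv ⟨m + 1, h⟩ t ht).2.1, one_mul] at this
        exact (sq_le_one_iff_abs_le_one _).1 (this.trans (hx1 t ht))
    have hσ := (tendsto_topSing_div_norm hL hd hsep hℓ hflow hgrad hinit huv ⟨m + 1, h⟩).abs
    have hmul := hσ.mul hvx
    rw [abs_one, mul_one] at hmul
    refine hmul.congr' ?_
    filter_upwards [eventually_ge_atTop 0] with t ht
    rw [weightProd, ← Matrix.mulVec_mulVec, weight_normalized,
      (huv ⟨m + 1, h⟩ t ht).dotProduct_smul_mulVec, abs_mul]

theorem abs_dotProduct_eq_of_dim_one {n : ℕ} (hn : n = 1) (i : Fin n) (x y : Fin n → ℝ)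
    (hx : x ⬝ᵥ x = 1) : |x ⬝ᵥ y| = |y i| := by
  subst hn
  have hi : i = 0 := Subsingleton.elim _ _
  simp only [dotProduct, Fin.sum_univ_one] at hx ⊢
  have h1 : |x 0| = 1 := by
    rw [← sq_eq_sq₀ (abs_nonneg _) zero_le_one, sq_abs, one_pow, sq, hx]
  rw [hi, abs_mul, h1, one_mul]

theorem normalized_prodVec_dotProduct (hd : d L = 1) (θ : Params L d) (x : Fin (d 0) → ℝ) :
    ((∏ j : Fin L, ‖weight θ j‖)⁻¹ • prodVec hd θ) ⬝ᵥ x =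
      (weightProd (normalized θ) L le_rfl *ᵥ x) (outIdx hd) := by
  rw [weightProd_normalized]
  rfl

end Alignment

end LinearMPNN

theorem mainTheorem3 (L : ℕ) (hL : 0 < L) (d : ℕ → ℕ) (hd : d L = 1)
    (k : ℕ) (data : Fin k → LinearMPNN.LabeledGraph (d 0))
    (hsep : LinearMPNN.Separable L data)
    (ℓ : ℝ → ℝ) (hℓ : LinearMPNN.LossAssumption ℓ)
    (W : ℝ → LinearMPNN.Params L d)
    (hflow : LinearMPNN.IsGradientFlow (LinearMPNN.risk hd ℓ data) W)
    (hgrad : gradient (LinearMPNN.risk hd ℓ data) (W 0) ≠ 0)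
    (hinit : LinearMPNN.risk hd ℓ data (W 0) ≤ LinearMPNN.risk hd ℓ data 0)
    (u : (j : Fin L) → ℝ → Fin (d (j + 1)) → ℝ)
    (v : (j : Fin L) → ℝ → Fin (d j) → ℝ)
    (huv : ∀ (j : Fin L) (t : ℝ), 0 ≤ t →
      LinearMPNN.IsTopSingularPair (LinearMPNN.weight (W t) j) (u j t) (v j t)) :
    (∀ j : Fin L, Tendsto (fun t : ℝ =>
        ‖‖LinearMPNN.weight (W t) j‖⁻¹ • LinearMPNN.weight (W t) j
            - Matrix.vecMulVec (u j t) (v j t)‖)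
        atTop (𝓝 0)) ∧
      Tendsto (fun t : ℝ =>
        |((∏ j : Fin L, ‖LinearMPNN.weight (W t) j‖)⁻¹ • LinearMPNN.prodVec hd (W t))
            ⬝ᵥ v ⟨0, hL⟩ t|)
        atTop (𝓝 1) := by
  refine ⟨fun j => ?_, ?_⟩
  · have hσ := LinearMPNN.tendsto_topSing_div_norm hL hd hsep hℓ hflow hgrad hinit huv j
    have hq := LinearMPNN.tendsto_norm_sq_weight hL hd hsep hℓ hflow hgrad hinit j
    have hlim := ((hσ.const_mul 2).const_sub 2).sqrt
    rw [mul_one, sub_self, Real.sqrt_zero] at hlim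
    refine hlim.congr' ?_
    filter_upwards [eventually_ge_atTop 0, hq.eventually_gt_atTop 0] with t ht hpos
    rw [← (huv j t ht).norm_normalized_sub_sq (by
      intro h0
      rw [h0] at hpos
      norm_num at hpos), Real.sqrt_sq (norm_nonneg _)]
  · obtain ⟨m, rfl⟩ : ∃ m, L = m + 1 := ⟨L - 1, by omega⟩
    have hlim := LinearMPNN.tendsto_abs_dotProduct_weightProd hL hd hsep hℓ hflow hgrad hinit huv
      m (Nat.lt_succ_self m)
    refine hlim.congr' ?_
    filter_upwards [eventually_ge_atTop 0] with t ht
    -- The output space is one-dimensional, so pairing with the unit vector `u` of the last layer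
    -- is, up to sign, evaluation at the only index.
    rw [LinearMPNN.normalized_prodVec_dotProduct, LinearMPNN.abs_dotProduct_eq_of_dim_one hd
      (LinearMPNN.outIdx hd) _ _ (huv ⟨m, Nat.lt_succ_self m⟩ t ht).1]
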